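/- For a finite graph $G$, a Roman dominating function is a map $f\colon V(G)\to\{0,1,2\}$ such that every vertex $v$ with $f(v)=0$ is adjacent to at least one vertex $w$ with $f(w)=2$; its weight is $\sum_{v\in V(G)} f(v)$, and the Roman domination number $\gamma_R(G)$ is the minimum weight of a Roman dominating function of $G$. Let $P_9$ be the path with $9$ vertices, $C_n$ the cycle with $n$ vertices, and $\Box$ the Cartesian product of graphs: $(u,v)$ and $(u',v')$ are adjacent in $G\Box H$ if and only if either $u=u'$ and $v,v'$ are adjacent in $H$, or $v=v'$ and $u,u'$ are adjacent in $G$. Then for every integer $n\ge 3$, $$\gamma_R(P_9\Box C_n)=\begin{cases}4n & \text{if } n\equiv 0\pmod 5,\\ 4n+2 & \text{otherwise.}\end{cases}$$ -/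

import Mathlib

/-- A Roman dominating function of `G`: a map `f : V(G) → {0, 1, 2}` such that every vertex of
value `0` is adjacent to at least one vertex of value `2`. -/
def SimpleGraph.IsRomanDominating {V : Type*} (G : SimpleGraph V) (f : V → Fin 3) : Prop :=
  ∀ v, f v = 0 → ∃ w, G.Adj v w ∧ f w = 2

/-- The weight `∑ v, f v` of a function `f : V → {0, 1, 2}`. -/
def romanWeight {V : Type*} [Fintype V] (f : V → Fin 3) : ℕ :=
  ∑ v, (f v : ℕ)

/-- The Roman domination number `γ_R(G)`: the minimum weight of a Roman dominating function. -/
noncomputable def SimpleGraph.romanDominationNumber {V : Type*} [Fintype V]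
    (G : SimpleGraph V) : ℕ :=
  sInf {k | ∃ f : V → Fin 3, G.IsRomanDominating f ∧ romanWeight f = k}

/-- The infimum in the definition of `γ_R(G)` is attained, so it is a minimum. -/
theorem SimpleGraph.isLeast_romanDominationNumber {V : Type*} [Fintype V] (G : SimpleGraph V) :
    IsLeast {k | ∃ f : V → Fin 3, G.IsRomanDominating f ∧ romanWeight f = k}
      G.romanDominationNumber := by
  have hne : {k | ∃ f : V → Fin 3, G.IsRomanDominating f ∧ romanWeight f = k}.Nonempty :=
    ⟨_, fun _ => 1, fun v hv => by simp at hv, rfl⟩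
  exact ⟨Nat.sInf_mem hne, fun k hk => Nat.sInf_le hk⟩

/-! Fix the set of vertices of value 2: the cheapest completion gives value 1 to the vertices it
leaves undominated. So the problem is to minimise a local cost over cyclic sequences of columns,
subsets of nine rows.

Lower bound. Cover the cylinder by two mirror-image bands, rows 0 to 5 and rows 8 to 3, and divide
30 times the weight between them, splitting the charge of the shared rows. A band is read by an
automaton whose 169 states record its last column and the vertices that only the next column can
still dominate. The potential `bandPotentials` shows that each band pays at least 60 per column on
average, so the weight is at least 4n (`sum_reducedCost`, `cyclicWeight_eq`). Weight 4n + 1 would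
mean a total excess of exactly 30. When 5 does not divide n, this is excluded by searching the pairs
of band walks that agree on the shared rows with excess at most 30: none closes up after a number of
steps prime to 5 (`checkStarts_eq_true`, `lt_sum_of_closed`). The search is finite because a closed
walk may start at its least state, and five steps leading back to the same state can be excised
without changing the length mod 5.

Upper bound. The perfect dominating pattern of the square lattice costs 20 per five columns; for the
other residues a short block is inserted at excess 2 (`exists_cylinderWeight_eq`). -/

/-- The low-cost transitions out of a state of the band automaton: for each value `m < 8` of the
three innermost bits of the next column, the pairs of cost and target. -/
structure BandNode where
  out0 : List (ℕ × ℕ)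
  out1 : List (ℕ × ℕ)
  out2 : List (ℕ × ℕ)
  out3 : List (ℕ × ℕ)
  out4 : List (ℕ × ℕ)
  out5 : List (ℕ × ℕ)
  out6 : List (ℕ × ℕ)
  out7 : List (ℕ × ℕ)

/-- The transitions of cost at most `30` of the band automaton, by number of the state, in rows of
`13` states. -/
def bandNodes : List (List BandNode) := [
  [⟨[], [], [], [], [], [], [], []⟩,
   ⟨[], [], [], [], [], [], [], []⟩,
   ⟨[(30, 6)], [], [], [], [], [], [], []⟩,
   ⟨[(28, 78)], [], [], [], [], [], [], []⟩,
   ⟨[(22, 78), (28, 103)], [], [], [], [], [], [], []⟩,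
   ⟨[(20, 63)], [], [(30, 88)], [], [(30, 130)], [], [], []⟩,
   ⟨[], [], [(29, 43)], [(23, 24), (29, 26)], [], [], [], [(29, 11), (29, 25)]⟩,
   ⟨[(13, 77)], [], [], [], [], [], [], []⟩,
   ⟨[(23, 121), (28, 0)], [], [(28, 17)], [], [(28, 111)], [], [(28, 7)], []⟩,
   ⟨[(13, 60)], [], [], [], [(27, 93)], [], [], []⟩,
   ⟨[(8, 1)], [], [], [], [], [], [], []⟩,
   ⟨[(7, 52)], [], [], [], [], [], [], []⟩,
   ⟨[(7, 0)], [], [], [], [], [], [], []⟩],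
  [⟨[(7, 127)], [], [], [], [(30, 166)], [], [], []⟩,
   ⟨[], [(20, 76)], [], [(26, 24)], [], [(20, 50)], [], []⟩,
   ⟨[(7, 118)], [], [], [], [(27, 163)], [], [], []⟩,
   ⟨[], [(20, 98)], [], [(26, 23)], [], [(20, 61)], [], [(29, 18)]⟩,
   ⟨[(7, 77)], [], [], [], [(25, 141)], [], [], []⟩,
   ⟨[(4, 40)], [], [], [], [(28, 147)], [], [], []⟩,
   ⟨[(18, 63), (29, 35), (29, 119)], [], [(28, 88), (29, 54)], [], [(28, 130), (29, 48), (29,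
    122)], [], [(29, 15)], []⟩,
   ⟨[], [(29, 76)], [(28, 17)], [(20, 24), (28, 4)], [], [(29, 50)], [(28, 7)], [(26, 25), (28,
    3)]⟩,
   ⟨[(2, 1), (28, 103)], [], [], [], [], [], [], []⟩,
   ⟨[(3, 31)], [], [(29, 133)], [], [(29, 150)], [], [(29, 113)], []⟩,
   ⟨[(1, 40)], [], [], [], [(25, 147)], [], [], []⟩,
   ⟨[(1, 2)], [], [], [], [(25, 45)], [], [], []⟩,
   ⟨[(1, 2)], [], [], [], [(25, 45)], [], [], []⟩],
  [⟨[(1, 52), (30, 103)], [], [], [], [(25, 153)], [], [], []⟩,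
   ⟨[(1, 0), (26, 121), (29, 140), (30, 85)], [], [], [], [], [], [], []⟩,
   ⟨[], [], [(28, 43), (29, 88), (30, 17), (30, 30), (30, 54)], [(22, 24), (25, 23), (28, 26),
    (30, 4)], [], [], [(30, 7), (30, 15)], [(28, 11), (28, 18), (28, 25), (30, 3)]⟩,
   ⟨[(27, 63)], [], [(22, 88), (23, 54), (28, 42)], [], [], [], [(23, 15), (27, 80), (28, 13)],
    []⟩,
   ⟨[(1, 31)], [], [(27, 133)], [], [(27, 150)], [], [(27, 113)], []⟩,
   ⟨[(29, 119)], [(21, 55), (29, 101)], [(29, 54)], [(27, 26), (29, 4)], [(29, 122)], [(21, 33),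
    (29, 47)], [(29, 15)], [(27, 11), (29, 3)]⟩,
   ⟨[(7, 103), (11, 1)], [], [], [], [(29, 159)], [], [], []⟩,
   ⟨[(7, 148)], [], [], [], [(7, 153)], [], [], []⟩,
   ⟨[(30, 110)], [(16, 76), (30, 101)], [(30, 17)], [(22, 24), (30, 4)], [(30, 111)], [(16, 50),
    (30, 47)], [(30, 7)], [(28, 25), (30, 3)]⟩,
   ⟨[], [(15, 71)], [], [(22, 72), (27, 62)], [], [(15, 49)], [], [(27, 32), (28, 73)]⟩,
   ⟨[(7, 1), (7, 51), (27, 78)], [], [], [], [], [], [], []⟩,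
   ⟨[(17, 121), (22, 0), (29, 60)], [], [(22, 17)], [], [(22, 111)], [], [(22, 7)], []⟩,
   ⟨[(7, 60), (25, 121), (28, 140), (30, 0)], [], [(28, 43), (30, 17), (30, 54)], [], [(21, 93),
    (30, 111), (30, 122)], [], [(30, 7), (30, 15)], []⟩],
  [⟨[(21, 6)], [], [(13, 112)], [], [(24, 41)], [], [(13, 38)], []⟩,
   ⟨[(19, 86), (28, 110), (28, 119)], [], [(26, 43), (28, 17), (28, 54)], [], [(19, 93), (28,
    111), (28, 122)], [], [(28, 7), (28, 15)], []⟩,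
   ⟨[(25, 86)], [(20, 76), (26, 55), (26, 68)], [], [(26, 24)], [(25, 93)], [(20, 50), (26, 33)],
    [], []⟩,
   ⟨[(1, 127), (27, 129)], [(25, 71)], [], [], [(24, 166), (27, 41)], [(25, 49)], [], []⟩,
   ⟨[(1, 16)], [], [(24, 99)], [], [(18, 124)], [], [(24, 59)], []⟩,
   ⟨[(1, 16)], [], [(24, 99)], [], [(18, 124)], [], [(24, 59)], []⟩,
   ⟨[(12, 6)], [], [(19, 112)], [], [(15, 41)], [], [(19, 38)], []⟩,
   ⟨[(25, 63), (27, 86), (30, 64)], [(22, 76), (25, 98), (28, 55), (28, 56), (28, 68), (28, 87)],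
    [], [(28, 24)], [(27, 93)], [(22, 50), (25, 61), (28, 33)], [], []⟩,
   ⟨[(7, 102), (25, 155)], [], [(29, 88), (30, 54)], [], [(7, 100), (26, 159)], [], [(30, 15)],
    []⟩,
   ⟨[], [(6, 71), (25, 138)], [], [(28, 72)], [], [(6, 49), (26, 123)], [], []⟩,
   ⟨[(7, 29), (23, 39)], [], [], [], [(7, 19), (23, 45)], [], [], []⟩,
   ⟨[(7, 39), (21, 29)], [], [], [], [(7, 45), (21, 19)], [], [], []⟩,
   ⟨[(20, 162), (21, 6)], [(22, 71)], [(28, 112), (28, 137)], [], [(21, 166), (24, 41)], [(22,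
    49)], [(28, 38), (28, 65)], []⟩],
  [⟨[(19, 64), (25, 35), (25, 110)], [], [(25, 17), (25, 30), (30, 42)], [], [(21, 81), (25, 48),
    (25, 111)], [], [(25, 7), (29, 22), (30, 13)], []⟩,
   ⟨[(7, 66), (25, 155), (30, 110)], [(30, 101)], [(30, 17), (30, 54), (30, 57)], [(30, 4)], [(7,
    67), (26, 159), (30, 111)], [(30, 47)], [(30, 7), (30, 9), (30, 15)], [(30, 3)]⟩,
   ⟨[(1, 118), (25, 121), (28, 140), (29, 85)], [(28, 156)], [(25, 157), (30, 17), (30, 54)], [],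
    [(21, 163), (30, 48), (30, 111), (30, 122)], [(29, 143)], [(26, 149), (30, 7), (30, 15)], []⟩,
   ⟨[(1, 148), (27, 155)], [(30, 156)], [(27, 157)], [], [(1, 153), (28, 159)], [], [(28, 149)],
    []⟩,
   ⟨[(1, 79), (25, 39)], [], [(29, 133)], [], [(1, 97), (25, 45)], [], [(29, 113)], []⟩,
   ⟨[(7, 60), (25, 121), (26, 120), (28, 108), (28, 140), (29, 85), (29, 142), (30, 0)], [],
    [(28, 43), (29, 88), (30, 17), (30, 30), (30, 54)], [], [(21, 93), (26, 81), (29, 130), (30,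
    48), (30, 111), (30, 122)], [], [(30, 7), (30, 15)], []⟩,
   ⟨[(1, 79), (25, 39)], [], [(29, 133)], [], [(1, 97), (25, 45)], [], [(29, 113)], []⟩,
   ⟨[(13, 85), (14, 0)], [], [(19, 42)], [], [(14, 48)], [], [(19, 13)], []⟩,
   ⟨[(9, 117)], [], [(15, 99)], [], [(9, 124)], [], [(15, 59)], []⟩,
   ⟨[(7, 144)], [(30, 138)], [(17, 112)], [], [(7, 147)], [], [(17, 38)], []⟩,
   ⟨[(1, 103), (5, 1), (25, 78)], [], [(27, 54)], [], [(23, 159)], [], [(27, 15)], []⟩,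
   ⟨[(28, 20)], [(26, 132)], [(19, 37)], [(11, 21)], [(28, 14)], [(26, 53)], [(19, 8)], [(11,
    10)]⟩,
   ⟨[(18, 146)], [], [(3, 133)], [], [(18, 150)], [], [(3, 113)], []⟩],
  [⟨[(7, 77), (7, 145), (25, 121), (28, 140)], [(30, 101)], [(28, 160), (30, 17), (30, 54)], [(30,
    4)], [(24, 167), (25, 141), (30, 111), (30, 122)], [(30, 47)], [(29, 154), (30, 7), (30,
    15)], [(30, 3)]⟩,
   ⟨[(27, 63), (29, 86)], [], [(21, 43), (22, 88), (23, 17), (23, 30), (23, 54), (28, 42)], [],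
    [(29, 93)], [], [(23, 7), (23, 15), (27, 22), (27, 44), (27, 80), (28, 13)], []⟩,
   ⟨[(18, 63), (20, 86), (23, 64), (27, 75), (29, 35), (29, 110), (29, 119)], [], [(27, 43), (28,
    88), (29, 17), (29, 30), (29, 54)], [], [(20, 93), (25, 81), (28, 130), (29, 48), (29, 111),
    (29, 122)], [], [(29, 7), (29, 15)], []⟩,
   ⟨[(1, 74), (25, 39)], [], [(24, 99)], [], [(1, 84), (25, 45)], [], [(24, 59)], []⟩,
   ⟨[(1, 74), (25, 39)], [], [(24, 99)], [], [(1, 84), (25, 45)], [], [(24, 59)], []⟩,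
   ⟨[(1, 1), (1, 51), (21, 78), (27, 103)], [], [(28, 42)], [], [(27, 152), (30, 67), (30, 100)],
    [], [(28, 13)], []⟩,
   ⟨[(1, 29), (17, 39)], [], [], [], [(1, 19), (17, 45)], [], [], []⟩,
   ⟨[(1, 2), (1, 5)], [], [], [], [(9, 19), (25, 45)], [], [], []⟩,
   ⟨[(1, 2), (1, 5)], [], [], [], [(9, 19), (25, 45)], [], [], []⟩,
   ⟨[(16, 35)], [], [(6, 42), (30, 88)], [(26, 23)], [(16, 48)], [], [(6, 13)], [(29, 18)]⟩,
   ⟨[(16, 96)], [], [(1, 27)], [], [(16, 114)], [], [(1, 12)], []⟩,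
   ⟨[(1, 39), (15, 29)], [], [], [], [(1, 45), (15, 19)], [], [], []⟩,
   ⟨[(22, 6)], [(12, 138), (23, 71)], [(29, 112)], [(20, 62)], [(25, 41)], [(13, 123), (23, 49)],
    [(29, 38)], [(20, 32)]⟩],
  [⟨[(4, 20)], [], [(10, 37)], [], [(4, 14)], [], [(10, 8)], []⟩,
   ⟨[(16, 119)], [], [(1, 54), (29, 43), (30, 88)], [(29, 26)], [(16, 122)], [], [(1, 15)], [(29,
    11)]⟩,
   ⟨[(2, 34)], [], [(10, 37)], [], [(4, 14)], [], [(10, 8)], []⟩,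
   ⟨[(7, 146)], [(29, 138)], [(7, 133)], [], [(7, 150)], [(30, 123)], [(7, 113)], []⟩,
   ⟨[(1, 2), (1, 131)], [], [(29, 133)], [], [(1, 97), (25, 45)], [], [(29, 113)], []⟩,
   ⟨[(1, 2), (1, 131)], [], [(29, 133)], [], [(1, 97), (25, 45)], [], [(29, 113)], []⟩,
   ⟨[(7, 35), (26, 63)], [(26, 98)], [(12, 42)], [], [(7, 48)], [(26, 61)], [(12, 13)], []⟩,
   ⟨[(29, 162), (30, 6)], [(1, 71), (20, 138)], [], [(23, 72), (28, 62)], [(30, 166)], [(1, 49),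
    (21, 123)], [], [(28, 32), (29, 73)]⟩,
   ⟨[(10, 117)], [], [(1, 99)], [], [(10, 124)], [], [(1, 59)], []⟩,
   ⟨[(1, 92)], [], [(10, 37)], [], [(1, 107)], [], [(10, 8)], []⟩,
   ⟨[(1, 34)], [], [(9, 37)], [], [(3, 14)], [], [(9, 8)], []⟩,
   ⟨[(1, 134)], [], [(10, 37)], [], [(1, 107)], [], [(10, 8)], []⟩,
   ⟨[(1, 92)], [], [(10, 37)], [], [(1, 107)], [], [(10, 8)], []⟩],
  [⟨[(1, 134)], [], [(10, 37)], [], [(1, 107)], [], [(10, 8)], []⟩,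
   ⟨[(16, 110)], [], [(1, 17), (29, 43)], [(23, 24)], [(16, 111)], [], [(1, 7)], [(29, 25)]⟩,
   ⟨[(1, 117)], [], [(7, 99)], [], [(1, 124)], [], [(7, 59)], []⟩,
   ⟨[(1, 2), (1, 128)], [], [(24, 99)], [], [(1, 84), (25, 45)], [], [(24, 59)], []⟩,
   ⟨[(1, 2), (1, 128)], [], [(24, 99)], [], [(1, 84), (25, 45)], [], [(24, 59)], []⟩,
   ⟨[], [(16, 101)], [], [(1, 4), (23, 24), (26, 23), (29, 26)], [], [(16, 47)], [], [(1, 3),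
    (29, 11), (29, 18), (29, 25)]⟩,
   ⟨[(7, 119), (26, 63), (28, 86)], [(29, 55)], [(7, 54)], [], [(7, 122), (28, 93)], [(29, 33)],
    [(7, 15)], []⟩,
   ⟨[(1, 144), (30, 155)], [(24, 138)], [(11, 112)], [], [(1, 147)], [(25, 123)], [(11, 38)], []⟩,
   ⟨[(7, 85), (8, 0)], [(27, 98)], [(13, 42)], [], [(8, 48)], [(27, 61)], [(13, 13)], []⟩,
   ⟨[(1, 20)], [(29, 132)], [(7, 37)], [(29, 21)], [(1, 14)], [(29, 53)], [(7, 8)], [(29, 10)]⟩,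
   ⟨[(1, 102), (19, 155), (29, 151)], [], [(23, 88), (24, 54), (29, 42)], [], [(1, 100), (20,
    159), (28, 152)], [], [(24, 15), (28, 80), (29, 13)], []⟩,
   ⟨[(10, 20)], [], [(1, 37)], [(23, 21)], [(10, 14)], [], [(1, 8)], [(23, 10)]⟩,
   ⟨[(17, 158), (26, 35), (26, 110), (26, 119)], [(24, 156)], [(21, 157), (26, 17), (26, 54)],
    [(27, 70)], [(17, 163), (26, 48), (26, 111), (26, 122)], [(25, 143)], [(22, 149), (26, 7),
    (26, 15)], [(27, 36)]⟩],
  [⟨[(1, 139)], [], [(1, 27)], [], [(1, 114)], [], [(1, 12)], []⟩,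
   ⟨[(1, 96)], [], [(1, 27)], [], [(1, 114)], [], [(1, 12)], []⟩,
   ⟨[(1, 139)], [], [(1, 27)], [], [(1, 114)], [], [(1, 12)], []⟩,
   ⟨[(7, 110), (28, 86)], [(23, 76)], [(7, 17)], [(29, 24)], [(7, 111), (28, 93)], [(23, 50)],
    [(7, 7)], []⟩,
   ⟨[(1, 96)], [], [(1, 27)], [], [(1, 114)], [], [(1, 12)], []⟩,
   ⟨[(7, 129), (11, 127)], [(24, 138)], [(11, 112)], [], [(7, 41)], [(25, 123)], [(11, 38)], []⟩,
   ⟨[(11, 136)], [], [(1, 135), (28, 160), (29, 88), (30, 17), (30, 30), (30, 54)], [(25, 23),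
    (30, 4)], [(10, 141)], [], [(1, 109), (29, 154), (30, 7), (30, 15)], [(28, 18), (30, 3)]⟩,
   ⟨[(2, 136), (25, 63), (30, 64), (30, 164)], [(25, 98)], [(7, 135)], [], [(1, 141), (30, 167)],
    [(25, 61)], [(7, 109)], []⟩,
   ⟨[(1, 60), (19, 121), (22, 140), (24, 0)], [], [(22, 43), (24, 17), (24, 54)], [], [(15, 93),
    (24, 111), (24, 122)], [], [(24, 7), (24, 15), (28, 44)], []⟩,
   ⟨[(7, 140), (9, 0), (16, 60)], [], [(9, 54)], [], [(9, 122), (30, 93)], [], [(9, 15)], []⟩,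
   ⟨[], [(7, 101), (23, 76), (26, 98), (29, 55)], [], [(7, 4), (29, 24)], [], [(7, 47), (23, 50),
    (26, 61), (29, 33)], [], [(7, 3)]⟩,
   ⟨[(1, 161), (25, 39)], [], [(1, 27)], [], [(1, 165), (25, 45)], [], [(1, 12)], []⟩,
   ⟨[(1, 161), (25, 39)], [], [(1, 27)], [], [(1, 165), (25, 45)], [], [(1, 12)], []⟩],
  [⟨[(29, 35)], [(18, 98), (29, 101)], [(19, 42)], [(9, 23), (14, 4)], [(29, 48)], [(18, 61), (29,
    47)], [(19, 13)], [(12, 18), (14, 3)]⟩,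
   ⟨[(23, 64), (29, 35), (29, 110)], [(15, 76), (18, 98), (21, 56), (29, 101)], [(29, 17), (29,
    30)], [(21, 24), (24, 23), (29, 4)], [(25, 81), (29, 48), (29, 111)], [(15, 50), (18, 61),
    (27, 58), (29, 47)], [(29, 7)], [(27, 18), (27, 25), (29, 3)]⟩,
   ⟨[], [(13, 156)], [(25, 157), (30, 17), (30, 54)], [(1, 70), (22, 24), (25, 23), (28, 26)],
    [], [(14, 143)], [(26, 149), (30, 7), (30, 15)], [(1, 36), (28, 11), (28, 18), (28, 25)]⟩,
   ⟨[(1, 146), (30, 136)], [(23, 138)], [(1, 133)], [], [(1, 150), (29, 141)], [(24, 123)], [(1,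
    113)], []⟩,
   ⟨[(1, 136), (24, 63), (29, 64), (29, 164)], [(24, 98)], [(6, 135)], [(30, 23)], [(0, 141),
    (29, 167)], [(24, 61)], [(6, 109)], []⟩,
   ⟨[(27, 158)], [(4, 156), (22, 76), (25, 98), (28, 55)], [], [(7, 70), (28, 24)], [(27, 163)],
    [(5, 143), (22, 50), (25, 61), (28, 33)], [], [(7, 36)]⟩,
   ⟨[(5, 155), (17, 66), (17, 102)], [], [(10, 54)], [], [(6, 159), (17, 67), (17, 100)], [],
    [(10, 15)], []⟩,
   ⟨[(20, 35)], [(9, 98), (20, 101)], [(25, 42)], [(15, 23), (20, 4)], [(20, 48)], [(9, 61), (20,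
    47)], [(25, 13)], [(18, 18), (20, 3)]⟩,
   ⟨[(1, 2), (1, 168)], [], [(1, 27)], [], [(1, 165), (25, 45)], [], [(1, 12)], []⟩,
   ⟨[(1, 2), (1, 168)], [], [(1, 27)], [], [(1, 165), (25, 45)], [], [(1, 12)], []⟩,
   ⟨[(18, 164), (20, 136), (24, 110), (24, 119)], [(24, 101)], [(22, 160), (24, 17), (24, 54),
    (25, 135)], [(24, 4)], [(18, 167), (19, 141), (24, 111), (24, 122)], [(24, 47)], [(23, 154),
    (24, 7), (24, 15), (25, 109)], [(24, 3)]⟩,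
   ⟨[(1, 35), (20, 63), (25, 64)], [(20, 98)], [(6, 42), (30, 88)], [(26, 23)], [(1, 48), (27,
    81), (30, 130)], [(20, 61)], [(6, 13)], [(29, 18)]⟩,
   ⟨[(19, 86), (28, 110), (28, 119)], [(14, 76), (20, 55), (20, 68), (28, 101)], [(26, 43), (28,
    17), (28, 54)], [(20, 24), (26, 26), (28, 4)], [(19, 93), (28, 111), (28, 122)], [(14, 50),
    (20, 33), (26, 69), (28, 47)], [(28, 7), (28, 15)], [(26, 11), (26, 25), (28, 3)]⟩],
  [⟨[(9, 20)], [(7, 132)], [(15, 37)], [(7, 21)], [(9, 14)], [(7, 53)], [(15, 8)], [(7, 10)]⟩,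
   ⟨[(1, 119), (20, 63), (22, 86)], [(23, 55)], [(1, 54), (29, 43), (30, 88)], [(29, 26)], [(1,
    122), (22, 93), (30, 130)], [(23, 33)], [(1, 15)], [(29, 11)]⟩,
   ⟨[(1, 66), (19, 155), (24, 110), (29, 151)], [(24, 101)], [(24, 17), (24, 54), (24, 57), (29,
    42)], [(24, 4)], [(1, 67), (20, 159), (24, 111), (28, 152)], [(24, 47)], [(24, 7), (24, 9),
    (24, 15), (29, 13)], [(24, 3)]⟩,
   ⟨[(1, 140), (3, 0), (10, 60), (28, 121)], [(25, 55)], [(3, 54)], [], [(3, 122), (24, 93)],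
    [(25, 33)], [(3, 15)], []⟩,
   ⟨[(1, 110), (22, 86), (25, 64)], [(17, 76)], [(1, 17), (29, 43)], [(23, 24)], [(1, 111), (22,
    93), (27, 81)], [(17, 50)], [(1, 7)], [(29, 25)]⟩,
   ⟨[(1, 129), (5, 127), (27, 140), (28, 85)], [(18, 138), (29, 71)], [(5, 112), (29, 54)], [(26,
    62)], [(1, 41), (28, 166), (29, 48), (29, 122)], [(19, 123), (29, 49)], [(5, 38), (29, 15)],
    [(26, 32)]⟩,
   ⟨[(18, 6)], [(8, 138), (19, 71)], [(10, 112)], [(1, 62), (26, 72), (29, 23)], [(21, 41)], [(9,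
    123), (19, 49)], [(10, 38)], [(1, 32)]⟩,
   ⟨[(1, 77), (1, 145), (19, 121), (22, 140)], [(24, 101)], [(22, 160), (24, 17), (24, 54), (25,
    135)], [(24, 4)], [(18, 167), (19, 141), (24, 111), (24, 122)], [(24, 47)], [(23, 154), (24,
    7), (24, 15), (25, 109)], [(24, 3)]⟩,
   ⟨[(0, 155), (12, 66), (12, 102), (26, 86)], [(27, 55)], [(5, 54)], [], [(1, 159), (12, 67),
    (12, 100), (26, 93)], [(27, 33)], [(5, 15)], []⟩,
   ⟨[], [(1, 101), (17, 76), (20, 98), (23, 55)], [], [(1, 4), (23, 24), (26, 23), (29, 26)], [],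
    [(1, 47), (17, 50), (20, 61), (23, 33)], [], [(1, 3), (29, 11), (29, 18), (29, 25)]⟩,
   ⟨[(23, 158)], [(0, 156), (18, 76), (21, 98), (24, 55)], [(27, 157)], [(3, 70), (24, 24), (27,
    23), (30, 26)], [(23, 163)], [(1, 143), (18, 50), (21, 61), (24, 33)], [(28, 149)], [(3, 36),
    (30, 11), (30, 18), (30, 25)]⟩,
   ⟨[(10, 6)], [(0, 138), (11, 71), (30, 98)], [(17, 112)], [(8, 62)], [(13, 41)], [(1, 123),
    (11, 49), (30, 61)], [(17, 38)], [(8, 32)]⟩,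
   ⟨[(3, 20)], [(1, 132)], [(9, 37)], [(1, 21)], [(3, 14)], [(1, 53)], [(9, 8)], [(1, 10)]⟩],
  [⟨[(6, 151), (8, 66), (8, 102), (25, 64), (26, 155)], [(20, 98)], [(6, 42), (30, 88)], [(26, 23)],
    [(5, 152), (8, 67), (8, 100), (27, 81), (27, 159)], [(20, 61)], [(6, 13)], [(29, 18)]⟩,
   ⟨[(10, 86), (19, 110), (19, 119)], [], [(2, 43), (4, 17), (4, 54)], [(26, 24)], [(10, 93),
    (19, 111), (19, 122)], [], [(4, 7), (4, 15), (8, 44)], []⟩,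
   ⟨[(12, 63), (23, 35), (23, 119)], [(12, 98), (15, 55), (15, 87), (23, 101)], [(22, 88), (23,
    54), (28, 42)], [(18, 23), (21, 26), (23, 4)], [(22, 130), (23, 48), (23, 122)], [(12, 61),
    (15, 33), (21, 90), (23, 47)], [(23, 15), (27, 80), (28, 13)], [(21, 11), (21, 18), (23, 3)]⟩,
   ⟨[(18, 119)], [(10, 55), (18, 101)], [(3, 54)], [(1, 26), (3, 4), (25, 24), (28, 23)], [(18,
    122)], [(10, 33), (18, 47)], [(3, 15)], [(1, 11), (3, 3)]⟩,
   ⟨[(1, 86), (10, 110), (10, 119), (29, 63)], [(26, 76)], [(8, 43), (10, 17), (10, 54)], [],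
    [(1, 93), (10, 111), (10, 122)], [(26, 50)], [(10, 7), (10, 15), (14, 44)], []⟩,
   ⟨[(10, 64), (16, 35), (16, 110)], [], [(1, 17), (1, 30), (6, 42), (29, 43), (30, 88)], [(23,
    24), (26, 23)], [(12, 81), (16, 48), (16, 111)], [], [(1, 7), (5, 22), (6, 13)], [(29, 18),
    (29, 25)]⟩,
   ⟨[(5, 121), (6, 120), (9, 85), (10, 0), (17, 60)], [(26, 76), (29, 98)], [(10, 17), (10, 30),
    (15, 42)], [], [(6, 81), (10, 48), (10, 111)], [(26, 50), (29, 61)], [(10, 7), (14, 22), (15,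
    13)], []⟩,
   ⟨[(9, 119), (28, 63), (30, 86)], [(1, 55), (9, 101), (25, 76), (28, 98)], [(9, 54)], [(7, 26),
    (9, 4)], [(9, 122), (30, 93)], [(1, 33), (9, 47), (25, 50), (28, 61)], [(9, 15)], [(7, 11),
    (9, 3)]⟩,
   ⟨[(8, 162), (9, 6)], [(10, 71), (29, 138)], [(1, 112), (1, 137), (23, 43), (25, 30), (25, 54),
    (30, 42)], [(17, 72), (22, 62)], [(9, 166), (12, 41)], [(10, 49), (30, 123)], [(1, 38), (1,
    65), (25, 15), (29, 22), (29, 44), (30, 13)], [(22, 32), (23, 73)]⟩,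
   ⟨[(0, 162), (1, 6), (23, 86), (26, 64)], [(2, 71), (21, 138)], [(8, 112), (8, 137), (30, 43)],
    [(24, 72), (29, 62)], [(1, 166), (4, 41), (23, 93), (28, 81)], [(2, 49), (22, 123)], [(8,
    38), (8, 65)], [(29, 32), (30, 73)]⟩,
   ⟨[(1, 64), (7, 35), (7, 110), (26, 63), (28, 86)], [(23, 76), (26, 98), (29, 56)], [(7, 17),
    (7, 30), (12, 42)], [(29, 24)], [(3, 81), (7, 48), (7, 111), (28, 93)], [(23, 50), (26, 61)],
    [(7, 7), (11, 22), (12, 13)], []⟩,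
   ⟨[(5, 140), (6, 85), (6, 142), (7, 0), (14, 60)], [(26, 98), (29, 55), (29, 87)], [(6, 88),
    (7, 54), (12, 42)], [], [(6, 130), (7, 48), (7, 122), (28, 93)], [(26, 61), (29, 33)], [(7,
    15), (11, 80), (12, 13)], []⟩,
   ⟨[(11, 158), (20, 35), (20, 110), (20, 119)], [(18, 156)], [(0, 157), (5, 17), (5, 54), (10,
    42)], [(6, 70), (27, 24), (30, 23)], [(11, 163), (20, 48), (20, 111), (20, 122)], [(19,
    143)], [(1, 149), (5, 7), (5, 15), (10, 13)], [(6, 36)]⟩],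
  [⟨[(1, 151), (3, 66), (3, 102), (20, 64), (21, 155), (26, 110)], [(15, 98), (26, 101)], [(1, 42),
    (25, 88), (26, 17), (26, 30), (26, 54), (26, 57)], [(21, 23), (26, 4)], [(0, 152), (3, 67),
    (3, 100), (22, 81), (22, 159), (26, 111)], [(15, 61), (26, 47)], [(1, 13), (26, 7), (26, 9),
    (26, 15), (30, 22), (30, 80)], [(24, 18), (26, 3)]⟩,
   ⟨[(0, 121), (1, 120), (4, 85), (5, 0), (12, 60)], [(21, 76), (24, 98), (27, 56)], [(5, 17),
    (5, 30), (10, 42)], [(27, 24), (30, 23)], [(1, 81), (5, 48), (5, 111), (26, 93)], [(21, 50),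
    (24, 61)], [(5, 7), (9, 22), (10, 13)], []⟩,
   ⟨[(18, 64), (24, 35), (24, 110)], [(10, 76), (13, 98), (16, 56), (24, 101)], [(9, 17), (9,
    30), (14, 42)], [(1, 24), (4, 23), (9, 4)], [(20, 81), (24, 48), (24, 111)], [(10, 50), (13,
    61), (22, 58), (24, 47)], [(9, 7), (13, 22), (14, 13)], [(7, 18), (7, 25), (9, 3)]⟩,
   ⟨[(1, 158), (10, 35), (10, 110), (10, 119), (29, 63)], [(8, 156), (26, 76), (29, 98)], [(5,
    157), (10, 17), (10, 54), (15, 42)], [(11, 70)], [(1, 163), (10, 48), (10, 111), (10, 122)],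
    [(9, 143), (26, 50), (29, 61)], [(6, 149), (10, 7), (10, 15), (15, 13)], [(11, 36)]⟩,
   ⟨[(0, 140), (1, 85), (1, 142), (2, 0), (9, 60), (27, 121), (28, 120), (30, 108)], [(21, 98),
    (24, 55), (24, 87)], [(1, 88), (2, 54), (7, 42), (30, 43)], [(27, 23), (30, 26)], [(1, 130),
    (2, 48), (2, 122), (23, 93), (28, 81)], [(21, 61), (24, 33), (30, 90)], [(2, 15), (6, 80),
    (7, 13)], [(30, 11), (30, 18)]⟩,
   ⟨[(16, 28), (16, 35), (16, 110), (16, 119)], [(16, 101)], [(1, 17), (1, 54), (1, 57), (6, 42),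
    (29, 43), (30, 88)], [(1, 4), (23, 24), (26, 23), (29, 26)], [(16, 46), (16, 48), (16, 111),
    (16, 122)], [(16, 47)], [(1, 7), (1, 9), (1, 15), (6, 13)], [(1, 3), (29, 11), (29, 18), (29,
    25)]⟩,
   ⟨[(11, 164), (13, 136), (17, 110), (17, 119)], [(17, 101)], [(0, 160), (2, 17), (2, 54), (3,
    135), (30, 43)], [(2, 4), (24, 24), (27, 23), (30, 26)], [(11, 167), (12, 141), (17, 111),
    (17, 122)], [(17, 47)], [(1, 154), (2, 7), (2, 15), (3, 109)], [(2, 3), (30, 11), (30, 18),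
    (30, 25)]⟩,
   ⟨[(9, 64), (15, 35), (15, 110)], [(1, 76), (4, 98), (7, 56), (15, 101)], [(15, 17), (15, 30),
    (20, 42)], [(7, 24), (10, 23), (15, 4)], [(11, 81), (15, 48), (15, 111)], [(1, 50), (4, 61),
    (13, 58), (15, 47)], [(15, 7), (19, 22), (20, 13)], [(13, 18), (13, 25), (15, 3)]⟩,
   ⟨[(10, 63), (21, 35), (21, 119)], [(10, 98), (13, 55), (13, 87), (21, 101)], [(5, 88), (6,
    54), (11, 42)], [(1, 23), (4, 26), (6, 4), (28, 24), (28, 89)], [(20, 130), (21, 48), (21,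
    122)], [(10, 61), (13, 33), (19, 90), (21, 47)], [(6, 15), (10, 80), (11, 13)], [(4, 11), (4,
    18), (6, 3)]⟩,
   ⟨[(7, 28), (7, 35), (7, 110), (7, 119), (26, 63), (28, 86)], [(7, 101), (23, 76), (26, 98),
    (29, 55)], [(7, 17), (7, 54), (7, 57), (12, 42)], [(7, 4), (29, 24)], [(7, 46), (7, 48), (7,
    111), (7, 122), (28, 93)], [(7, 47), (23, 50), (26, 61), (29, 33)], [(7, 7), (7, 9), (7, 15),
    (12, 13)], [(7, 3)]⟩,
   ⟨[(1, 164), (3, 136), (7, 110), (7, 119), (26, 63), (28, 86)], [(7, 101), (23, 76), (26, 98),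
    (29, 55)], [(5, 160), (7, 17), (7, 54), (8, 135)], [(7, 4), (29, 24)], [(1, 167), (2, 141),
    (7, 111), (7, 122), (28, 93)], [(7, 47), (23, 50), (26, 61), (29, 33)], [(6, 154), (7, 7),
    (7, 15), (8, 109)], [(7, 3)]⟩,
   ⟨[(1, 63), (12, 35), (12, 119)], [(1, 98), (4, 55), (4, 87), (12, 101), (28, 76)], [(11, 88),
    (12, 54), (17, 42)], [(7, 23), (10, 26), (12, 4)], [(11, 130), (12, 48), (12, 122)], [(1,
    61), (4, 33), (10, 90), (12, 47), (28, 50)], [(12, 15), (16, 80), (17, 13)], [(10, 11), (10,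
    18), (12, 3)]⟩,
   ⟨[(1, 28), (1, 35), (1, 110), (1, 119), (20, 63), (22, 86), (25, 64)], [(1, 101), (17, 76),
    (20, 98), (23, 55)], [(1, 17), (1, 54), (1, 57), (6, 42), (29, 43), (30, 88)], [(1, 4), (23,
    24), (26, 23), (29, 26)], [(1, 46), (1, 48), (1, 111), (1, 122), (22, 93), (27, 81), (30,
    130)], [(1, 47), (17, 50), (20, 61), (23, 33)], [(1, 7), (1, 9), (1, 15), (6, 13)], [(1, 3),
    (29, 11), (29, 18), (29, 25)]⟩]]

/-- A potential on the states of the band automaton for which all reduced costs are nonnegative. -/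
def bandPotentials : List ℕ := [
  30, 52, 121, 90, 84, 61, 31, 96, 88, 36, 120, 122, 97, 91, 64, 96, 61, 90, 122, 59, 58, 114,
  122, 119, 122, 122, 116, 91, 0, 53, 120, 59, 93, 98, 60, 60, 89, 82, 60, 97, 58, 34, 85, 122,
  122, 103, 6, 60, 66, 120, 104, 82, 55, 90, 90, 92, 122, 30, 122, 74, 113, 101, 87, 101, 96,
  90, 23, 29, 122, 122, 83, 114, 122, 122, 61, 122, 98, 83, 122, 61, 122, 100, 122, 122, 67,
  61, 99, 122, 121, 122, 122, 122, 61, 105, 122, 122, 61, 67, 95, 68, 119, 54, 113, 86, 122,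
  122, 122, 67, 122, 95, 60, 66, 54, 69, 67, 122, 122, 44, 29, 60, 94, 65, 66, 70, 50, 122,
  122, 84, 61, 28, 97, 61, 84, 63, 61, 89, 64, 84, 65, 61, 62, 71, 91, 61, 34, 23, 33, 40, 31,
  40, 39, 55, 62, 37, 37, 65, 56, 35, 9, 70, 32, 61, 62, 15, 6, 67, 67, 12, 61]

/-- The numbers of the states with last column `S`, as the digits in base `256`. -/
def bandIndexRows : List ℕ := [
  12676451875173320798492497652098730050210693414020385763160968245711061876904,
  943598134203958229046620859177591788098950091009203590932965741297666,
  746975106511015010949202708234457765355585906213463517036647,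
  395457409329360888156363535088018707490332040617741288210510,
  9637477195934819162209695631682539284887935, 21778071482940061661655974875633165533304,
  29264283555200707857850216239132066185276, 25521177519070384759753095557382615859308,
  1703582852, 98, 55, 87, 19527, 56, 68, 115, 4138980842485932827, 180388626567, 54, 88, 4489,
  30, 43, 104, 71190037, 23, 26, 89, 6216, 82, 94, 125, 61360679171131651702673630233391879333,
  3802951803285679119535991423021, 2250502776992565297311, 2398076729582241710180, 28582, 81,
  93, 105, 796626741, 61, 33, 90, 12849, 58, 69, 116, 659378259639745292, 55834574957, 15, 80,
  1857, 22, 44, 106, 52438026, 18, 11, 91, 6473, 83, 95, 126]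

/-- The states of the band automaton, sorted by the bits they share with the opposite band. -/
def bandClasses : List (List ℕ) := [
  [0, 1, 2, 5, 16, 31, 34, 40, 51, 52, 60, 77, 78, 85, 103, 108, 118, 120, 121, 127, 128, 129,
    131, 134, 139, 140, 142, 145, 168],
  [6, 20, 28, 29, 35, 39, 63, 64, 66, 74, 75, 79, 86, 92, 96, 102, 110, 117, 119, 136, 144, 146,
    148, 151, 155, 158, 161, 162, 164],
  [55, 56, 68, 71, 76, 87, 98, 101, 115, 132, 138, 156],
  [],
  [17, 27, 30, 37, 42, 43, 54, 57, 88, 99, 104, 112, 133, 135, 137, 157, 160],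
  [],
  [4, 21, 23, 24, 26, 62, 70, 72, 82, 89, 94, 125],
  [],
  [14, 19, 41, 45, 46, 48, 67, 81, 84, 93, 97, 100, 105, 107, 111, 114, 122, 124, 130, 141, 147,
    150, 152, 153, 159, 163, 165, 166, 167],
  [],
  [33, 47, 49, 50, 53, 58, 61, 69, 90, 116, 123, 143],
  [],
  [7, 8, 9, 12, 13, 15, 22, 38, 44, 59, 65, 80, 106, 109, 113, 149, 154],
  [],
  [3, 10, 11, 18, 25, 32, 36, 73, 83, 91, 95, 126],
  []]

/-! ### The band automaton and the two kernel computations -/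

/-- The entry number `i` of a list, by a direct recursion that the kernel evaluates quickly. -/
noncomputable def nth {α : Type*} (d : α) (l : List α) : ℕ → α :=
  List.rec (fun _ => d) (fun a _ ih i => Nat.rec a (fun k _ => ih k) i) l

/-- The two-level lookup shortens the path to each of the 169 entries. -/
noncomputable def bandNode (i : ℕ) : BandNode :=
  nth ⟨[], [], [], [], [], [], [], []⟩ (nth [] bandNodes (i / 13)) (i % 13)

/-- The transitions whose next column has innermost bits `m`. -/
def BandNode.out (N : BandNode) : ℕ → List (ℕ × ℕ)
  | 0 => N.out0
  | 1 => N.out1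
  | 2 => N.out2
  | 3 => N.out3
  | 4 => N.out4
  | 5 => N.out5
  | 6 => N.out6
  | _ => N.out7

noncomputable def bandPotential (i : ℕ) : ℕ := nth 0 bandPotentials i

/-- The number of the band state with last column `S` and undominated set `U`. -/
noncomputable def bandIndex (S U : ℕ) : ℕ := (nth 0 bandIndexRows S >>> (8 * U)) % 256

/-- The binary digit number `r` of `m`. -/
def bit (m r : ℕ) : ℕ := (m >>> r) % 2

/-- The vertices of rows `0` to `4` dominated neither by the column `p` nor by the preceding
column `S`. -/
def bandStep (S p : ℕ) : ℕ :=
  31 - (31 &&& (S ||| p ||| (p >>> 1) ||| (p <<< 1)))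

/-- The cost of the column `p` following a band state with undominated set `U`. -/
def bandCost (U p : ℕ) : ℕ :=
  -- Rows 3, 4, 5 of the grid lie in both bands, in opposite order; the shares 54 + 6, 30 + 30, 6 +
  -- 54 restore 60, and the 15 for an undominated vertex of row 4 is charged twice.
  60 * bit p 0 + 60 * bit p 1 + 60 * bit p 2 + 54 * bit p 3 + 30 * bit p 4 + 6 * bit p 5 +
    (30 * (bit U 0 * (1 - bit p 0)) + 30 * (bit U 1 * (1 - bit p 1)) +
      30 * (bit U 2 * (1 - bit p 2)) + 30 * (bit U 3 * (1 - bit p 3)) +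
      15 * (bit U 4 * (1 - bit p 4)))

/-- No undominated vertex is in or next to the last column `S`. -/
def isBandState (S U : ℕ) : Bool := (U &&& (S ||| (S >>> 1) ||| (S <<< 1))) == 0

/-- The reduced cost of a transition is nonnegative, and if it is at most `30`, then the transition
is listed in `bandNodes`. -/
noncomputable def checkStep (S U p : ℕ) : Bool :=
  let a := bandCost U p + bandPotential (bandIndex S U)
  let j := bandIndex p (bandStep S p)
  -- 60 is the average charged to one band per column; an excess of 31 alone breaks the budget of
  -- 30.
  let b := bandPotential j + 60
  b.ble a && ((b + 31).ble a || ((bandNode (bandIndex S U)).out (p / 8)).elem (a - b, j))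

noncomputable def checkSteps : Bool :=
  (List.range 64).all fun S => (List.range 32).all fun U =>
    !(isBandState S U) || (((nth [] bandClasses (2 * (S / 8) + U / 16)).elem (bandIndex S U)) &&
    ((List.range 64).all fun p => checkStep S U p))

theorem checkSteps_eq_true : checkSteps = true := by decide +kernel

/-- All pairs of a transition from `L` and a transition from `L'` with total cost at most `B`
satisfy `P`. -/
noncomputable def allPairs (B : ℕ) (P : ℕ → ℕ → ℕ → Bool) (L L' : List (ℕ × ℕ)) : Bool :=
  List.rec true (fun e _ ih =>
    bif e.1.ble B then
      List.rec ih (fun e' _ ih' =>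
        bif (e.1 + e'.1).ble B then P (e.1 + e'.1) e.2 e'.2 && ih' else ih') L'
    else ih) L

noncomputable def allOut (B : ℕ) (P : ℕ → ℕ → ℕ → Bool) (N N' : BandNode) : Bool :=
  allPairs B P N.out0 N'.out0 && allPairs B P N.out1 N'.out4 && allPairs B P N.out2 N'.out2 &&
  allPairs B P N.out3 N'.out6 && allPairs B P N.out4 N'.out1 && allPairs B P N.out5 N'.out5 &&
  allPairs B P N.out6 N'.out3 && allPairs B P N.out7 N'.out7

/-- Every walk of cost at most `B` from `(i, j)` that extends the walk `h` returns to `(i₀, j₀)` only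
after a multiple of `5` steps. Walks are cut off where they visit a pair smaller than `(i₀, j₀)` or
repeat the state five steps before; all others end within `fuel` steps. -/
noncomputable def noReturn (i₀ j₀ fuel : ℕ) : List ℕ → ℕ → ℕ → ℕ → Bool :=
  -- Running out of fuel counts as failure, so success means that every walk was followed to its
  -- end.
  Nat.rec (fun _ _ _ _ => false) (fun _ ih h i j B =>
    allOut B (fun c i' j' =>
      bif (i₀ + j₀).ble (i' + j') then
        (!(i'.beq i₀ && j'.beq j₀) || (h.length % 5).beq 0) &&
        -- Position 4 of the history is four steps before the current pair, hence five before the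
        -- next one.
        ((nth 0 h 4).beq (256 * i' + j' + 1) ||
          ih ((256 * i' + j' + 1) :: h) i' j' (B - c))
      else true)
      (bandNode i) (bandNode j)) fuel

noncomputable def checkStarts (L L' : List ℕ) : Bool :=
  L.all fun i => L'.all fun j => noReturn i j 20 [256 * i + j + 1] i j 30

/-- The reversal of three bits. -/
def reverseBits (m : ℕ) : ℕ := 4 * (m % 2) + 2 * (m / 2 % 2) + m / 4

theorem checkStarts_eq_true : ((List.range 8).all fun m => (List.range 2).all fun u =>
    checkStarts (nth [] bandClasses (2 * m + u))
      (nth [] bandClasses (2 * reverseBits m + u))) = true := by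
  decide +kernel

/-! ### Soundness of the search -/

theorem of_allPairs {B : ℕ} {P : ℕ → ℕ → ℕ → Bool} {L L' : List (ℕ × ℕ)}
    (h : allPairs B P L L' = true) {c i c' i' : ℕ} (hL : (c, i) ∈ L) (hL' : (c', i') ∈ L')
    (hB : c + c' ≤ B) : P (c + c') i i' = true := by
  induction L with
  | nil => simp at hL
  | cons e L ih =>
    -- The base case of the inner recursion is the rest of the outer one, so the outer conclusion
    -- has to be carried through the inner list.
    have key : ∀ M : List (ℕ × ℕ), (List.rec (allPairs B P L L') (fun e' _ ih' =>
        bif (e.1 + e'.1).ble B then P (e.1 + e'.1) e.2 e'.2 && ih' else ih') M : Bool) = true →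
        allPairs B P L L' = true ∧
          ∀ e' ∈ M, e.1 + e'.1 ≤ B → P (e.1 + e'.1) e.2 e'.2 = true := by
      intro M
      induction M with
      | nil => intro hM; exact ⟨hM, by simp⟩
      | cons e' M ihM =>
        intro hM
        by_cases he : e.1 + e'.1 ≤ B
        · have hM' := hM
          simp only [Nat.ble_eq_true_of_le he, cond_true, Bool.and_eq_true] at hM'
          refine ⟨(ihM hM'.2).1, fun e'' h'' => ?_⟩
          rcases List.mem_cons.1 h'' with rfl | h''
          · exact fun _ => hM'.1
          · exact (ihM hM'.2).2 e'' h''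
        · have hf : (e.1 + e'.1).ble B = false := by
            rw [← Bool.not_eq_true, Nat.ble_eq]; exact he
          have hM' := hM
          simp only [hf, cond_false] at hM'
          refine ⟨(ihM hM').1, fun e'' h'' => ?_⟩
          rcases List.mem_cons.1 h'' with rfl | h''
          · exact fun h => absurd h he
          · exact (ihM hM').2 e'' h''
    have h' : (bif e.1.ble B then (List.rec (allPairs B P L L') (fun e' _ ih' =>
        bif (e.1 + e'.1).ble B then P (e.1 + e'.1) e.2 e'.2 && ih' else ih') L' : Bool)
        else allPairs B P L L') = true := h
    by_cases he : e.1 ≤ B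
    · rw [Nat.ble_eq_true_of_le he, cond_true] at h'
      obtain ⟨h1, h2⟩ := key L' h'
      rcases List.mem_cons.1 hL with rfl | hL
      · exact h2 _ hL' hB
      · exact ih h1 hL
    · have hf : e.1.ble B = false := by
        rw [← Bool.not_eq_true, Nat.ble_eq]; exact he
      rw [hf, cond_false] at h'
      rcases List.mem_cons.1 hL with rfl | hL
      · exact absurd (le_trans (Nat.le_add_right _ _) hB) he
      · exact ih h' hL

/-- `reverseBits` swaps 1 with 4 and 3 with 6 and fixes 0, 2, 5, 7, which is the pairing in
`allOut`. -/
theorem of_allOut {B : ℕ} {P : ℕ → ℕ → ℕ → Bool} {N N' : BandNode}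
    (h : allOut B P N N' = true) {m c i c' i' : ℕ} (hm : m < 8) (hN : (c, i) ∈ N.out m)
    (hN' : (c', i') ∈ N'.out (reverseBits m)) (hB : c + c' ≤ B) : P (c + c') i i' = true := by
  simp only [allOut, Bool.and_eq_true] at h
  obtain ⟨⟨⟨⟨⟨⟨⟨h0, h1⟩, h2⟩, h3⟩, h4⟩, h5⟩, h6⟩, h7⟩ := h
  interval_cases m
  exacts [of_allPairs h0 hN hN' hB, of_allPairs h1 hN hN' hB, of_allPairs h2 hN hN' hB,
    of_allPairs h3 hN hN' hB, of_allPairs h4 hN hN' hB, of_allPairs h5 hN hN' hB,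
    of_allPairs h6 hN hN' hB, of_allPairs h7 hN hN' hB]

/-- A transition of total cost `c` in both bands; the three bits shared by the two next columns
appear in opposite orders. Transitions of high cost are not recorded in the tables. -/
def BandEdge (v : ℕ × ℕ) (c : ℕ) (w : ℕ × ℕ) : Prop :=
  ∃ m < 8, ∃ a b, c = a + b ∧ (a ≤ 30 → (a, w.1) ∈ (bandNode v.1).out m) ∧
    (b ≤ 30 → (b, w.2) ∈ (bandNode v.2).out (reverseBits m))

/-- The two bands agree on the bits they share. -/
def BandsMatch (v : ℕ × ℕ) : Prop :=
  ∃ m < 8, ∃ u < 2, v.1 ∈ nth [] bandClasses (2 * m + u) ∧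
    v.2 ∈ nth [] bandClasses (2 * reverseBits m + u)

/-- Injective when second components are below 256; the `+ 1` keeps 0 free as the default of `nth`.
-/
def pairCode (v : ℕ × ℕ) : ℕ := 256 * v.1 + v.2 + 1

/-- The codes of `v d, …, v 0`. -/
def history (v : ℕ → ℕ × ℕ) : ℕ → List ℕ
  | 0 => [pairCode (v 0)]
  | d + 1 => pairCode (v (d + 1)) :: history v d

theorem length_history (v : ℕ → ℕ × ℕ) (d : ℕ) : (history v d).length = d + 1 := by
  induction d with
  | zero => rfl
  | succ d ih => simp [history, ih]

theorem nth_history (v : ℕ → ℕ × ℕ) (d k : ℕ) :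
    nth 0 (history v d) k = if k ≤ d then pairCode (v (d - k)) else 0 := by
  induction d generalizing k with
  | zero =>
    cases k with
    | zero => rfl
    | succ k => rfl
  | succ d ih =>
    cases k with
    | zero => rfl
    | succ k =>
      have : nth 0 (history v (d + 1)) (k + 1) = nth 0 (history v d) k := rfl
      rw [this, ih]
      simp

/-- By `hmin` and `hfresh` the search never cuts off such a walk. It follows the walk until the fuel
is spent or the return at step `n` fails the test mod 5; either way the answer is `false`. -/
theorem noReturn_eq_false {v : ℕ → ℕ × ℕ} {c : ℕ → ℕ} {n : ℕ}
    (hE : ∀ k < n, BandEdge (v k) (c k) (v (k + 1))) (hn : v n = v 0) (h5 : n % 5 ≠ 0)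
    (hmin : ∀ k ≤ n, (v 0).1 + (v 0).2 ≤ (v k).1 + (v k).2)
    (hfresh : ∀ k, k + 5 ≤ n → v k ≠ v (k + 5)) (hlt : ∀ k, (v k).2 < 256) (fuel : ℕ) :
    ∀ d < n, ∀ B ≤ 30, ∑ k ∈ Finset.Ico d n, c k ≤ B →
      noReturn (v 0).1 (v 0).2 fuel (history v d) (v d).1 (v d).2 B = false := by
  induction fuel with
  | zero => intros; rfl
  | succ fuel ih =>
    intro d hd B hB hsum
    rw [← Bool.not_eq_true]
    intro h
    obtain ⟨m, hm, a, b, hc, ha, hb⟩ := hE d hd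
    rw [Finset.sum_eq_sum_Ico_succ_bot hd] at hsum
    have hab : a + b ≤ B := by omega
    have := of_allOut (N := bandNode (v d).1) (N' := bandNode (v d).2) h hm (ha (by omega))
      (hb (by omega)) hab
    simp only [Nat.ble_eq_true_of_le (hmin (d + 1) hd), cond_true, Bool.and_eq_true,
      Bool.or_eq_true, length_history, nth_history, Nat.beq_eq] at this
    obtain ⟨h1, h2 | h2⟩ := this
    -- When the history is too short, the lookup gives 0, which is not a code.
    · split_ifs at h2 with h4
      · refine hfresh (d - 4) (by omega) ?_
        rw [show d - 4 + 5 = d + 1 by omega]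
        have h3 := hlt (d - 4)
        have h3' := hlt (d + 1)
        unfold pairCode at h2
        exact Prod.ext (by omega) (by omega)
    · by_cases hdn : d + 1 = n
      · have e : v (d + 1) = v 0 := by rw [hdn, hn]
        rw [e] at h1
        simp at h1
        omega
      · have := ih (d + 1) (by omega) (B - (a + b)) (by omega) (by omega)
        exact absurd h2 (by rw [← Bool.not_eq_true] at this; exact this)

/-! ### Closed walks: rotation and excision -/

theorem succ_mod_eq_ite (a n : ℕ) (hn : 0 < n) :
    (a + 1) % n = if a % n + 1 = n then 0 else a % n + 1 := by
  have h := Nat.mod_lt a hn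
  rw [← Nat.mod_add_mod]
  split_ifs with h'
  · rw [h', Nat.mod_self]
  · exact Nat.mod_eq_of_lt (by omega)

theorem sum_range_add_mod {n : ℕ} (hn : 0 < n) (m : ℕ) (c : ℕ → ℕ) :
    ∑ k ∈ Finset.range n, c ((m + k) % n) = ∑ k ∈ Finset.range n, c k := by
  have hmaps : Set.MapsTo (fun k => (m + k) % n) (Finset.range n) (Finset.range n) := by
    intro k _
    simpa using Nat.mod_lt _ hn
  have hinj : Set.InjOn (fun k => (m + k) % n) (Finset.range n) := by
    intro a ha b hb hab
    have := Nat.ModEq.add_left_cancel' m hab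
    simp only [Finset.coe_range, Set.mem_Iio] at ha hb
    exact Nat.ModEq.eq_of_lt_of_lt this ha hb
  exact Finset.sum_nbij (fun k => (m + k) % n) hmaps hinj
    (Finset.surjOn_of_injOn_of_card_le _ hmaps hinj le_rfl) (fun _ _ => rfl)

/-- A closed walk can be rotated so that it starts at its least vertex. -/
theorem exists_rotation {n : ℕ} (hn0 : 0 < n) {v : ℕ → ℕ × ℕ} {c : ℕ → ℕ}
    (hE : ∀ k < n, BandEdge (v k) (c k) (v (k + 1))) (hn : v n = v 0)
    (hlt : ∀ k, (v k).2 < 256) (hmatch : ∀ k, BandsMatch (v k)) :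
    ∃ (w : ℕ → ℕ × ℕ) (d : ℕ → ℕ), (∀ k < n, BandEdge (w k) (d k) (w (k + 1))) ∧ w n = w 0 ∧
      (∀ k, (w k).2 < 256) ∧ (∀ k, BandsMatch (w k)) ∧
      (∀ k ≤ n, (w 0).1 + (w 0).2 ≤ (w k).1 + (w k).2) ∧
      ∑ k ∈ Finset.range n, d k = ∑ k ∈ Finset.range n, c k := by
  obtain ⟨m, hm, hmin⟩ := Finset.exists_min_image (Finset.range n)
    (fun k => (v k).1 + (v k).2) ⟨0, Finset.mem_range.2 hn0⟩
  refine ⟨fun k => v ((m + k) % n), fun k => c ((m + k) % n), fun k _ => ?_, ?_,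
    fun k => hlt _, fun k => hmatch _, fun k _ => ?_, sum_range_add_mod hn0 m c⟩
  · have h := hE ((m + k) % n) (Nat.mod_lt _ hn0)
    change BandEdge (v ((m + k) % n)) (c ((m + k) % n)) (v ((m + k + 1) % n))
    rw [succ_mod_eq_ite _ _ hn0]
    -- At the wrap-around, the last edge ends in `v n = v 0`.
    split_ifs with h'
    · rwa [h', hn] at h
    · exact h
  · simp
  · have := hmin ((m + k) % n) (Finset.mem_range.2 (Nat.mod_lt _ hn0))
    simpa [Nat.mod_eq_of_lt (Finset.mem_range.1 hm)] using this

/-- A closed walk of length not divisible by `5` has total cost more than `30`. -/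
theorem lt_sum_of_closed {n : ℕ} {v : ℕ → ℕ × ℕ} {c : ℕ → ℕ}
    (hE : ∀ k < n, BandEdge (v k) (c k) (v (k + 1))) (hn : v n = v 0) (h5 : n % 5 ≠ 0)
    (hlt : ∀ k, (v k).2 < 256) (hmatch : ∀ k, BandsMatch (v k)) :
    30 < ∑ k ∈ Finset.range n, c k := by
  induction n using Nat.strong_induction_on generalizing v c with
  | _ n IH =>
  obtain ⟨v, c, hE, hn, hlt, hmatch, hmin, hsum⟩ := exists_rotation
    (Nat.pos_of_ne_zero (by rintro rfl; simp at h5)) hE hn hlt hmatch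
  rw [← hsum]
  -- If a pair recurs after five steps, excise these: the cost does not grow, the length mod 5 is
  -- unchanged, and induction applies.
  by_cases hrep : ∃ k, k + 5 ≤ n ∧ v k = v (k + 5)
  · obtain ⟨k, hk, hv⟩ := hrep
    obtain ⟨t, rfl⟩ := Nat.exists_eq_add_of_le hk
    have := IH (k + t) (by omega) (v := fun m => if m ≤ k then v m else v (m + 5))
      (c := fun m => if m < k then c m else c (m + 5)) ?_ ?_ (by omega) ?_ ?_
    · refine this.trans_le ?_
      rw [Finset.sum_range_add, Finset.sum_range_add, Finset.sum_range_add]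
      have h1 : ∑ x ∈ Finset.range k, (if x < k then c x else c (x + 5)) =
          ∑ x ∈ Finset.range k, c x :=
        Finset.sum_congr rfl fun x hx => if_pos (Finset.mem_range.1 hx)
      have h2 : ∑ x ∈ Finset.range t, (if k + x < k then c (k + x) else c (k + x + 5)) =
          ∑ x ∈ Finset.range t, c (k + 5 + x) :=
        Finset.sum_congr rfl fun x hx => by
          rw [if_neg (by omega)]; congr 1; omega
      rw [h1, h2]
      omega
    · intro m hm
      rcases lt_trichotomy m k with h | h | h
      · rw [if_pos h.le, if_pos h, if_pos (by omega)]
        exact hE m (by omega)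
      · subst h
        rw [if_pos le_rfl, if_neg (lt_irrefl _), if_neg (by omega), hv,
          show m + 1 + 5 = m + 5 + 1 by omega]
        exact hE (m + 5) (by omega)
      · rw [if_neg (by omega), if_neg (by omega), if_neg (by omega),
          show m + 1 + 5 = m + 5 + 1 by omega]
        exact hE (m + 5) (by omega)
    · rw [if_pos (Nat.zero_le k)]
      -- If nothing follows the excised part, the new walk ends at `v k = v (k + 5)`, the old
      -- endpoint.
      split_ifs with h
      · obtain rfl : t = 0 := by omega
        exact hv.trans hn
      · rw [show k + t + 5 = k + 5 + t by omega]
        exact hn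
    · intro m
      split_ifs <;> exact hlt _
    · intro m
      split_ifs <;> exact hmatch _
  · push Not at hrep
    obtain ⟨m, hm, u, hu, h1, h2⟩ := hmatch 0
    by_contra! hle
    have h := checkStarts_eq_true
    simp only [List.all_eq_true, List.mem_range, checkStarts] at h
    have h3 := noReturn_eq_false hE hn h5 hmin hrep hlt 20 0
      (Nat.pos_of_ne_zero (by rintro rfl; simp at h5)) 30 le_rfl
      (by rwa [Nat.Ico_zero_eq_range])
    exact absurd (h m hm u hu _ h1 _ h2) (by rw [← Bool.not_eq_true] at h3; exact h3)

/-! ### Columns and their division into two bands -/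

/-- A column of the grid, given by the set of its vertices of value `2`. -/
abbrev Column := Fin 9 → Bool

/-- Whether the vertex in row `r` of the column `b` with neighbouring columns `a` and `d` is
undominated. -/
def undominated (a b d : Column) (r : Fin 9) : Bool :=
  !(b r || a r || d r || (decide (r ≠ 0) && b (r - 1)) || (decide (r ≠ 8) && b (r + 1)))

def undominatedCount (a b d : Column) : ℕ := ∑ r, (undominated a b d r).toNat

def columnCount (b : Column) : ℕ := ∑ r, (b r).toNat

def columnWeight (a b d : Column) : ℕ := 2 * columnCount b + undominatedCount a b d

def pack5 (b₀ b₁ b₂ b₃ b₄ : Bool) : ℕ :=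
  b₀.toNat + 2 * b₁.toNat + 4 * b₂.toNat + 8 * b₃.toNat + 16 * b₄.toNat

def pack6 (b₀ b₁ b₂ b₃ b₄ b₅ : Bool) : ℕ := pack5 b₀ b₁ b₂ b₃ b₄ + 32 * b₅.toNat

theorem pack6_lt : ∀ b₀ b₁ b₂ b₃ b₄ b₅, pack6 b₀ b₁ b₂ b₃ b₄ b₅ < 64 := by decide

theorem pack5_lt : ∀ b₀ b₁ b₂ b₃ b₄, pack5 b₀ b₁ b₂ b₃ b₄ < 32 := by decide

theorem pack6_div : ∀ b₀ b₁ b₂ b₃ b₄ b₅,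
    pack6 b₀ b₁ b₂ b₃ b₄ b₅ / 8 = b₃.toNat + 2 * b₄.toNat + 4 * b₅.toNat := by decide

theorem pack5_div : ∀ b₀ b₁ b₂ b₃ b₄, pack5 b₀ b₁ b₂ b₃ b₄ / 16 = b₄.toNat := by decide

theorem reverseBits_pack : ∀ b₀ b₁ b₂ : Bool,
    reverseBits (b₀.toNat + 2 * b₁.toNat + 4 * b₂.toNat) =
      b₂.toNat + 2 * b₁.toNat + 4 * b₀.toNat := by decide

theorem bandStep_pack : ∀ a₀ a₁ a₂ a₃ a₄ a₅ b₀ b₁ b₂ b₃ b₄ b₅,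
    bandStep (pack6 a₀ a₁ a₂ a₃ a₄ a₅) (pack6 b₀ b₁ b₂ b₃ b₄ b₅) =
      pack5 (!(a₀ || b₀ || b₁)) (!(a₁ || b₁ || b₂ || b₀)) (!(a₂ || b₂ || b₃ || b₁))
        (!(a₃ || b₃ || b₄ || b₂)) (!(a₄ || b₄ || b₅ || b₃)) := by
  decide +kernel

/-- `bandStep` removes everything dominated by the newest column; hence `checkSteps` covers every
state that arises. -/
theorem isBandState_bandStep : ∀ a₀ a₁ a₂ a₃ a₄ a₅ b₀ b₁ b₂ b₃ b₄ b₅,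
    isBandState (pack6 b₀ b₁ b₂ b₃ b₄ b₅)
      (bandStep (pack6 a₀ a₁ a₂ a₃ a₄ a₅) (pack6 b₀ b₁ b₂ b₃ b₄ b₅)) = true := by
  decide +kernel

theorem bandCost_pack : ∀ u₀ u₁ u₂ u₃ u₄ p₀ p₁ p₂ p₃ p₄ p₅ : Bool,
    bandCost (pack5 u₀ u₁ u₂ u₃ u₄) (pack6 p₀ p₁ p₂ p₃ p₄ p₅) =
      60 * p₀.toNat + 60 * p₁.toNat + 60 * p₂.toNat + 54 * p₃.toNat + 30 * p₄.toNat +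
      6 * p₅.toNat + (30 * (u₀ && !p₀).toNat + 30 * (u₁ && !p₁).toNat + 30 * (u₂ && !p₂).toNat +
      30 * (u₃ && !p₃).toNat + 15 * (u₄ && !p₄).toNat) := by
  decide +kernel

/-- Rows `0` to `5` of a column. -/
def topBand (b : Column) : ℕ := pack6 (b 0) (b 1) (b 2) (b 3) (b 4) (b 5)

/-- Rows `8` to `3` of a column, in this order. -/
def bottomBand (b : Column) : ℕ := pack6 (b 8) (b 7) (b 6) (b 5) (b 4) (b 3)

theorem sum_fin_nine (f : Fin 9 → ℕ) :
    ∑ r, f r = f 0 + f 1 + f 2 + f 3 + f 4 + f 5 + f 6 + f 7 + f 8 := by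
  rw [Fin.sum_univ_castSucc, Fin.sum_univ_eight]
  rfl

theorem undominated_interior (a b d : Column) (r : Fin 9) (h₀ : r ≠ 0) (h₈ : r ≠ 8) :
    undominated a b d r = (!(a r || b r || b (r + 1) || b (r - 1)) && !d r) := by
  unfold undominated
  rw [decide_eq_true h₀, decide_eq_true h₈]
  cases a r <;> cases b r <;> cases d r <;> cases b (r + 1) <;> cases b (r - 1) <;> rfl

theorem undominated_top (a b d : Column) :
    undominated a b d 0 = (!(a 0 || b 0 || b 1) && !d 0) := by
  change (!(b 0 || a 0 || d 0 || false || (true && b 1))) = _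
  cases a 0 <;> cases b 0 <;> cases d 0 <;> cases b 1 <;> rfl

theorem undominated_bottom (a b d : Column) :
    undominated a b d 8 = (!(a 8 || b 8 || b 7) && !d 8) := by
  change (!(b 8 || a 8 || d 8 || (true && b 7) || false)) = _
  cases a 8 <;> cases b 8 <;> cases d 8 <;> cases b 7 <;> rfl

/-- Outer rows are charged in one band only, and the shares of rows 3, 4, 5 add up. The step charges
the value-2 vertices of the new column `d`, but the undominated vertices of `b`, whose status `d`
settles. -/
theorem bandCost_add_bandCost (a b d : Column) :
    bandCost (bandStep (topBand a) (topBand b)) (topBand d) +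
      bandCost (bandStep (bottomBand a) (bottomBand b)) (bottomBand d) =
      30 * (2 * columnCount d + undominatedCount a b d) := by
  have h : ∀ r : Fin 9, r ≠ 0 ∧ r ≠ 8 → undominated a b d r =
      (!(a r || b r || b (r + 1) || b (r - 1)) && !d r) :=
    fun r hr => undominated_interior a b d r hr.1 hr.2
  have h' : ∀ r : Fin 9, r ≠ 0 ∧ r ≠ 8 → undominated a b d r =
      (!(a r || b r || b (r - 1) || b (r + 1)) && !d r) := fun r hr => by
    rw [h r hr, Bool.or_right_comm]
  have e1 : _ = (!(a 1 || b 1 || b 2 || b 0) && !d 1) := h 1 (by decide)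
  have e2 : _ = (!(a 2 || b 2 || b 3 || b 1) && !d 2) := h 2 (by decide)
  have e3 : _ = (!(a 3 || b 3 || b 4 || b 2) && !d 3) := h 3 (by decide)
  have e4 : _ = (!(a 4 || b 4 || b 5 || b 3) && !d 4) := h 4 (by decide)
  have e5 : _ = (!(a 5 || b 5 || b 4 || b 6) && !d 5) := h' 5 (by decide)
  have e6 : _ = (!(a 6 || b 6 || b 5 || b 7) && !d 6) := h' 6 (by decide)
  have e7 : _ = (!(a 7 || b 7 || b 6 || b 8) && !d 7) := h' 7 (by decide)
  rw [columnCount, undominatedCount, sum_fin_nine, sum_fin_nine, undominated_top,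
    undominated_bottom, e1, e2, e3, e4, e5, e6, e7]
  -- The bands list the vertical neighbours of row 4 in opposite orders.
  rw [topBand, topBand, topBand, bottomBand, bottomBand, bottomBand, bandStep_pack, bandStep_pack,
    bandCost_pack, bandCost_pack, Bool.or_right_comm (a 4 || b 4) (b 3) (b 5)]
  ring

/-- The facts about a transition of the band automaton that were checked by computation. -/
theorem band_facts (a₀ a₁ a₂ a₃ a₄ a₅ b₀ b₁ b₂ b₃ b₄ b₅ d₀ d₁ d₂ d₃ d₄ d₅ : Bool) :
    let S := pack6 b₀ b₁ b₂ b₃ b₄ b₅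
    let U := bandStep (pack6 a₀ a₁ a₂ a₃ a₄ a₅) S
    let p := pack6 d₀ d₁ d₂ d₃ d₄ d₅
    let i := bandIndex S U
    let j := bandIndex p (bandStep S p)
    i ∈ nth [] bandClasses (2 * (S / 8) + U / 16) ∧
    bandPotential j + 60 ≤ bandCost U p + bandPotential i ∧
    (bandCost U p + bandPotential i - (bandPotential j + 60) ≤ 30 →
      (bandCost U p + bandPotential i - (bandPotential j + 60), j) ∈
        (bandNode i).out (p / 8)) := by
  intro S U p i j
  have h := checkSteps_eq_true
  simp only [checkSteps, List.all_eq_true, List.mem_range] at h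
  have h := h S (pack6_lt _ _ _ _ _ _) U (by
    simp only [U, S, bandStep_pack]; exact pack5_lt _ _ _ _ _)
  rw [isBandState_bandStep] at h
  simp only [Bool.not_true, Bool.false_or, Bool.and_eq_true, List.all_eq_true, List.mem_range,
    List.elem_eq_mem, decide_eq_true_eq] at h
  have h1 := h.2 p (pack6_lt _ _ _ _ _ _)
  simp only [checkStep, Bool.and_eq_true, Bool.or_eq_true, Nat.ble_eq, List.elem_eq_mem,
    decide_eq_true_eq] at h1
  have h2 : bandPotential j + 60 ≤ bandCost U p + bandPotential i := h1.1
  refine ⟨h.1, h2, fun hle => h1.2.resolve_left ?_⟩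
  change ¬ (bandPotential j + 60 + 31 ≤ bandCost U p + bandPotential i)
  omega

/-! ### The lower bound for cyclic sequences of columns -/

/-- The total weight of a cyclic sequence of columns, in the positions `1, …, n`. -/
def cyclicWeight (x : ℕ → Column) (n : ℕ) : ℕ :=
  ∑ k ∈ Finset.range n, columnWeight (x k) (x (k + 1)) (x (k + 2))

/-- The state of a band after two consecutive columns. -/
noncomputable def bandState (band : Column → ℕ) (x : ℕ → Column) (k : ℕ) : ℕ :=
  bandIndex (band (x (k + 1))) (bandStep (band (x k)) (band (x (k + 1))))

def bandStepCost (band : Column → ℕ) (x : ℕ → Column) (k : ℕ) : ℕ :=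
  bandCost (bandStep (band (x k)) (band (x (k + 1)))) (band (x (k + 2)))

/-- The excess of the cost of a step over the average, corrected by the potential. -/
noncomputable def reducedCost (band : Column → ℕ) (x : ℕ → Column) (k : ℕ) : ℕ :=
  bandStepCost band x k + bandPotential (bandState band x k) -
    (bandPotential (bandState band x (k + 1)) + 60)

/-- The potentials cancel around a period; `hle` makes the truncated subtraction exact. -/
theorem sum_reducedCost {band : Column → ℕ} {x : ℕ → Column} {n : ℕ}
    (hx : ∀ k, x (k + n) = x k)
    (hle : ∀ k, bandPotential (bandState band x (k + 1)) + 60 ≤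
      bandStepCost band x k + bandPotential (bandState band x k)) :
    ∑ k ∈ Finset.range n, reducedCost band x k + 60 * n =
      ∑ k ∈ Finset.range n, bandStepCost band x k := by
  have h0 : bandState band x n = bandState band x 0 := by
    unfold bandState
    rw [add_comm n 1, hx, show x n = x 0 by simpa using hx 0]
  have h1 : ∑ k ∈ Finset.range n, bandPotential (bandState band x (k + 1)) =
      ∑ k ∈ Finset.range n, bandPotential (bandState band x k) := by
    have := Finset.sum_range_succ (fun k => bandPotential (bandState band x k)) n
    rw [Finset.sum_range_succ', h0] at this
    omega
  have h2 : ∑ k ∈ Finset.range n,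
      (reducedCost band x k + (bandPotential (bandState band x (k + 1)) + 60)) =
      ∑ k ∈ Finset.range n, (bandStepCost band x k + bandPotential (bandState band x k)) :=
    Finset.sum_congr rfl fun k _ => Nat.sub_add_cancel (hle k)
  simp only [Finset.sum_add_distrib, Finset.sum_const, Finset.card_range, smul_eq_mul] at h2
  omega

/-- A step charges vertices one column later than `columnWeight` does; periodicity absorbs the
shift. -/
theorem cyclicWeight_eq {x : ℕ → Column} {n : ℕ} (hx : ∀ k, x (k + n) = x k) :
    ∑ k ∈ Finset.range n, bandStepCost topBand x k +
      ∑ k ∈ Finset.range n, bandStepCost bottomBand x k = 30 * cyclicWeight x n := by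
  rw [← Finset.sum_add_distrib]
  simp only [bandStepCost, bandCost_add_bandCost, cyclicWeight, columnWeight]
  rw [← Finset.mul_sum, Finset.sum_add_distrib, Finset.sum_add_distrib, ← Finset.mul_sum,
    ← Finset.mul_sum]
  congr 3
  have := Finset.sum_range_succ (fun k => columnCount (x (k + 1))) n
  rw [Finset.sum_range_succ', add_comm n 1, hx] at this
  simpa using this

theorem le_cyclicWeight {x : ℕ → Column} {n : ℕ} (hx : ∀ k, x (k + n) = x k) :
    (if n ≡ 0 [MOD 5] then 4 * n else 4 * n + 2) ≤ cyclicWeight x n := by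
  have ht : ∀ k, _ := fun k => band_facts (x k 0) (x k 1) (x k 2) (x k 3) (x k 4) (x k 5)
    (x (k + 1) 0) (x (k + 1) 1) (x (k + 1) 2) (x (k + 1) 3) (x (k + 1) 4) (x (k + 1) 5)
    (x (k + 2) 0) (x (k + 2) 1) (x (k + 2) 2) (x (k + 2) 3) (x (k + 2) 4) (x (k + 2) 5)
  have hb : ∀ k, _ := fun k => band_facts (x k 8) (x k 7) (x k 6) (x k 5) (x k 4) (x k 3)
    (x (k + 1) 8) (x (k + 1) 7) (x (k + 1) 6) (x (k + 1) 5) (x (k + 1) 4) (x (k + 1) 3)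
    (x (k + 2) 8) (x (k + 2) 7) (x (k + 2) 6) (x (k + 2) 5) (x (k + 2) 4) (x (k + 2) 3)
  have h1 := sum_reducedCost (band := topBand) hx fun k => (ht k).2.1
  have h2 := sum_reducedCost (band := bottomBand) hx fun k => (hb k).2.1
  have h3 := cyclicWeight_eq hx
  split_ifs with h5
  · omega
  · have h4 := lt_sum_of_closed (n := n)
      (v := fun k => (bandState topBand x k, bandState bottomBand x k))
      (c := fun k => reducedCost topBand x k + reducedCost bottomBand x k) ?_ ?_ h5 ?_ ?_
    -- 30 times the weight is at least 120n + 31, so by integrality the weight is at least 4n + 2.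
    · rw [Finset.sum_add_distrib] at h4
      omega
    · intro k _
      refine ⟨topBand (x (k + 2)) / 8, ?_, _, _, rfl, (ht k).2.2, ?_⟩
      · exact Nat.div_lt_of_lt_mul (pack6_lt _ _ _ _ _ _)
      · rw [topBand, pack6_div, reverseBits_pack, ← pack6_div (x (k + 2) 8) (x (k + 2) 7)
          (x (k + 2) 6)]
        exact (hb k).2.2
    · simp only [bandState]
      rw [add_comm n 1, hx, show x n = x 0 by simpa using hx 0]
    · intro k
      exact Nat.mod_lt _ (by norm_num)
    · intro k
      refine ⟨topBand (x (k + 1)) / 8, Nat.div_lt_of_lt_mul (pack6_lt _ _ _ _ _ _),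
        bandStep (topBand (x k)) (topBand (x (k + 1))) / 16, ?_, (ht k).1, ?_⟩
      · rw [topBand, topBand, bandStep_pack]
        exact Nat.div_lt_of_lt_mul (pack5_lt _ _ _ _ _)
      · have h := (hb k).1
        rw [topBand, topBand, pack6_div, reverseBits_pack, ← pack6_div (x (k + 1) 8)
          (x (k + 1) 7) (x (k + 1) 6)]
        -- The last undominated bit of either band concerns the same vertex, in row 4.
        convert h using 3
        · rw [bandStep_pack, bandStep_pack, pack5_div, pack5_div]
          simp only [Bool.or_assoc, Bool.or_comm]
        · rfl

/-! ### Roman dominating functions as sequences of columns -/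

open SimpleGraph in
-- The side conditions on `r` suppress the wrap-around of `Fin 9`; that of `Fin (m + 3)` is the
-- cycle itself.
theorem adj_cylinder {m : ℕ} {r s : Fin 9} {i j : Fin (m + 3)} :
    (boxProd (pathGraph 9) (cycleGraph (m + 3))).Adj (r, i) (s, j) ↔
      ((r ≠ 0 ∧ s = r - 1 ∨ r ≠ 8 ∧ s = r + 1) ∧ j = i) ∨ ((j = i - 1 ∨ j = i + 1) ∧ s = r) := by
  rw [boxProd_adj, pathGraph_adj, cycleGraph_adj]
  have h1 : (r : ℕ) + 1 = s ∨ (s : ℕ) + 1 = r ↔ (r ≠ 0 ∧ s = r - 1 ∨ r ≠ 8 ∧ s = r + 1) := by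
    revert r s
    decide
  have h2 : i - j = 1 ∨ j - i = 1 ↔ j = i - 1 ∨ j = i + 1 := by
    rw [sub_eq_iff_eq_add, sub_eq_iff_eq_add, eq_sub_iff_add_eq, add_comm 1 j, add_comm 1 i,
      eq_comm (a := i)]
  simp only [h1, h2, eq_comm (a := i), eq_comm (a := r)]

theorem undominated_eq_false_iff {a b d : Column} {r : Fin 9} :
    undominated a b d r = false ↔ b r = true ∨ a r = true ∨ d r = true ∨
      (r ≠ 0 ∧ b (r - 1) = true) ∨ (r ≠ 8 ∧ b (r + 1) = true) := by
  rw [undominated, Bool.not_eq_false']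
  simp [or_assoc]

/-- The weight of the least Roman dominating function of the cylinder whose vertices of value `2`
are those given by `y`. -/
def cylinderWeight {n : ℕ} [NeZero n] (y : Fin n → Column) : ℕ :=
  ∑ i, columnWeight (y (i - 1)) (y i) (y (i + 1))

theorem romanWeight_eq_sum {n : ℕ} (f : Fin 9 × Fin n → Fin 3) :
    romanWeight f = ∑ i, ∑ r, (f (r, i) : ℕ) := by
  rw [romanWeight, Fintype.sum_prod_type, Finset.sum_comm]

theorem cylinderWeight_eq_sum {n : ℕ} [NeZero n] (y : Fin n → Column) :
    cylinderWeight y =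
      ∑ i, ∑ r, (2 * (y i r).toNat + (undominated (y (i - 1)) (y i) (y (i + 1)) r).toNat) := by
  simp only [cylinderWeight, columnWeight, columnCount, undominatedCount,
    Finset.sum_add_distrib, Finset.mul_sum]

open SimpleGraph in
-- Keep the vertices of value 2: one they leave undominated cannot have value 0, so it already pays
-- at least 1.
theorem exists_cylinderWeight_le {m : ℕ} {f : Fin 9 × Fin (m + 3) → Fin 3}
    (hf : (boxProd (pathGraph 9) (cycleGraph (m + 3))).IsRomanDominating f) :
    ∃ y : Fin (m + 3) → Column, cylinderWeight y ≤ romanWeight f := by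
  refine ⟨fun i r => decide (f (r, i) = 2), ?_⟩
  rw [cylinderWeight_eq_sum, romanWeight_eq_sum]
  refine Finset.sum_le_sum fun i _ => Finset.sum_le_sum fun r _ => ?_
  by_cases h2 : f (r, i) = 2
  · rw [undominated_eq_false_iff.2 (Or.inl (decide_eq_true h2))]
    simp [h2]
  · by_cases h0 : f (r, i) = 0
    · obtain ⟨⟨s, j⟩, hadj, hw⟩ := hf _ h0
      rw [undominated_eq_false_iff.2]
      · simp [h0]
      · simp only [decide_eq_true_eq]
        rcases adj_cylinder.1 hadj with ⟨⟨h, rfl⟩ | ⟨h, rfl⟩, rfl⟩ | ⟨rfl | rfl, rfl⟩ <;> tauto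
    · have h1 : f (r, i) = 1 := by omega
      refine (Nat.add_le_add le_rfl (Bool.toNat_le _)).trans ?_
      simp [h1]

open SimpleGraph in
theorem exists_isRomanDominating {m : ℕ} (y : Fin (m + 3) → Column) :
    ∃ f, (boxProd (pathGraph 9) (cycleGraph (m + 3))).IsRomanDominating f ∧
      romanWeight f = cylinderWeight y := by
  refine ⟨fun v => if y v.2 v.1 then 2 else
    if undominated (y (v.2 - 1)) (y v.2) (y (v.2 + 1)) v.1 then 1 else 0, ?_, ?_⟩
  · rintro ⟨r, i⟩ h0
    by_cases h1 : y i r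
    · simp [h1] at h0
    · by_cases h2 : undominated (y (i - 1)) (y i) (y (i + 1)) r
      · simp [h1, h2] at h0
      · rw [Bool.not_eq_true] at h2
        rcases undominated_eq_false_iff.1 h2 with h | h | h | ⟨h', h⟩ | ⟨h', h⟩
        · exact absurd h h1
        · exact ⟨(r, i - 1), adj_cylinder.2 (by tauto), by simp [h]⟩
        · exact ⟨(r, i + 1), adj_cylinder.2 (by tauto), by simp [h]⟩
        · exact ⟨(r - 1, i), adj_cylinder.2 (by tauto), by simp [h]⟩
        · exact ⟨(r + 1, i), adj_cylinder.2 (by tauto), by simp [h]⟩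
  · rw [romanWeight_eq_sum, cylinderWeight_eq_sum]
    refine Finset.sum_congr rfl fun i _ => Finset.sum_congr rfl fun r _ => ?_
    by_cases h1 : y i r
    · rw [undominated_eq_false_iff.2 (Or.inl h1)]
      simp [h1]
    · by_cases h2 : undominated (y (i - 1)) (y i) (y (i + 1)) r <;> simp [h1, h2]

theorem cylinderWeight_eq_cyclicWeight {m : ℕ} (y : Fin (m + 3) → Column) :
    cylinderWeight y = cyclicWeight (fun k => y (Fin.ofNat (m + 3) k)) (m + 3) := by
  have hs : ∀ k, Fin.ofNat (m + 3) (k + 1) = Fin.ofNat (m + 3) k + 1 := fun k => by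
    ext; simp [Fin.ofNat, Fin.val_add]
  rw [cylinderWeight, ← Equiv.sum_comp (Equiv.addRight 1), cyclicWeight,
    ← Fin.sum_univ_eq_sum_range (fun k => columnWeight (y (Fin.ofNat (m + 3) k))
      (y (Fin.ofNat (m + 3) (k + 1))) (y (Fin.ofNat (m + 3) (k + 2))))]
  refine Finset.sum_congr rfl fun i _ => ?_
  have hi : Fin.ofNat (m + 3) (i : ℕ) = i := by ext; simp [Fin.ofNat, Nat.mod_eq_of_lt i.2]
  rw [show (i : ℕ) + 2 = i + 1 + 1 from rfl]
  simp only [hs, hi, Equiv.coe_addRight, add_sub_cancel_right]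

theorem le_cylinderWeight {m : ℕ} (y : Fin (m + 3) → Column) :
    (if m + 3 ≡ 0 [MOD 5] then 4 * (m + 3) else 4 * (m + 3) + 2) ≤ cylinderWeight y := by
  rw [cylinderWeight_eq_cyclicWeight]
  exact le_cyclicWeight fun k => by congr 1; ext; simp [Fin.ofNat]

/-! ### Optimal patterns and the upper bound -/

def maskColumn (a : ℕ) : Column := fun r => a.testBit r

/-- The sum of the weights of the inner columns of a list of columns, given as bit masks. -/
def windowWeight : List ℕ → ℕ
  | a :: b :: d :: l =>
    columnWeight (maskColumn a) (maskColumn b) (maskColumn d) + windowWeight (b :: d :: l)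
  | _ => 0

theorem windowWeight_eq_sum (l : List ℕ) (a b : ℕ) :
    windowWeight (a :: b :: l) = ∑ k ∈ Finset.range l.length,
      columnWeight (maskColumn ((a :: b :: l).getD k 0))
        (maskColumn ((a :: b :: l).getD (k + 1) 0)) (maskColumn ((a :: b :: l).getD (k + 2) 0)) := by
  induction l generalizing a b with
  | nil => rfl
  | cons d l ih =>
    rw [windowWeight, ih, List.length_cons, Finset.sum_range_succ', add_comm]
    rfl

/-- `k` periods of a perfect pattern followed by the columns `33`, `132` and `l`. -/
def patternColumns (l : List ℕ) : ℕ → List ℕ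
  | 0 => 33 :: 132 :: l
  -- Column `c` of the period holds the rows congruent to `2 * c` mod 5: nine vertices of value 2,
  -- leaving two undominated at the boundary, hence weight 20.
  | k + 1 => 33 :: 132 :: 16 :: 66 :: 264 :: patternColumns l k

theorem exists_patternColumns (l : List ℕ) (k : ℕ) :
    ∃ t, patternColumns l k = 33 :: 132 :: t := by
  cases k <;> exact ⟨_, rfl⟩

theorem length_patternColumns (l : List ℕ) (k : ℕ) :
    (patternColumns l k).length = l.length + 2 + 5 * k := by
  induction k with
  | zero => rfl
  | succ k ih => simp only [patternColumns, List.length_cons, ih]; ring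

/-- Every such list starts with 33, 132, so prefixing a period keeps the old windows and adds five,
centred at 132, 16, 66, 264, 33. -/
theorem windowWeight_patternColumns (l : List ℕ) (k : ℕ) :
    windowWeight (patternColumns l k ++ [33, 132]) =
      windowWeight (33 :: 132 :: l ++ [33, 132]) + 20 * k := by
  induction k with
  | zero => rfl
  | succ k ih =>
    rw [mul_add, ← add_assoc, ← ih]
    obtain ⟨t, ht⟩ := exists_patternColumns l k
    rw [patternColumns, ht]
    simp only [List.cons_append, windowWeight]
    have : columnWeight (maskColumn 33) (maskColumn 132) (maskColumn 16) +
      columnWeight (maskColumn 132) (maskColumn 16) (maskColumn 66) +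
      columnWeight (maskColumn 16) (maskColumn 66) (maskColumn 264) +
      columnWeight (maskColumn 66) (maskColumn 264) (maskColumn 33) +
      columnWeight (maskColumn 264) (maskColumn 33) (maskColumn 132) = 20 := by decide
    omega

/-- Repeating the first two columns at the end makes each column of the cycle inner exactly once. -/
theorem exists_cylinderWeight_eq_windowWeight {m : ℕ} {a b : ℕ} {t : List ℕ}
    (hl : t.length = m + 1) :
    ∃ y : Fin (m + 3) → Column, cylinderWeight y = windowWeight (a :: b :: t ++ [a, b]) := by
  refine ⟨fun i => maskColumn ((a :: b :: t).getD i 0), ?_⟩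
  rw [cylinderWeight_eq_cyclicWeight, List.cons_append, List.cons_append, windowWeight_eq_sum,
    cyclicWeight]
  have h : ∀ k < m + 5, (a :: b :: t).getD (Fin.ofNat (m + 3) k : Fin (m + 3)) 0 =
      (a :: b :: (t ++ [a, b])).getD k 0 := by
    intro k hk
    have hlen : (a :: b :: t).length = m + 3 := by simp [hl]
    rw [← List.cons_append, ← List.cons_append]
    by_cases hk' : k < m + 3
    · rw [List.getD_append _ _ _ _ (by omega)]
      simp [Fin.ofNat, Nat.mod_eq_of_lt hk']
    · rw [List.getD_append_right _ _ _ _ (by omega), hlen]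
      obtain rfl | rfl : k = m + 3 ∨ k = m + 3 + 1 := by omega
      · simp [Fin.ofNat]
      · simp [Fin.ofNat]
  have hlen : (t ++ [a, b]).length = m + 3 := by simp [hl]
  rw [hlen]
  refine Finset.sum_congr rfl fun k hk => ?_
  have := Finset.mem_range.1 hk
  rw [h k (by omega), h (k + 1) (by omega), h (k + 2) (by omega)]

theorem exists_cylinderWeight_eq_add {m c : ℕ} (l : List ℕ) (k : ℕ)
    (hl : l.length + 5 * k = m + 1)
    (hc : windowWeight (33 :: 132 :: l ++ [33, 132]) = 4 * (l.length + 2) + c) :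
    ∃ y : Fin (m + 3) → Column, cylinderWeight y = 4 * (m + 3) + c := by
  obtain ⟨t, ht⟩ := exists_patternColumns l k
  have h := length_patternColumns l k
  have h' := windowWeight_patternColumns l k
  rw [ht] at h h'
  simp only [List.length_cons] at h
  obtain ⟨y, hy⟩ := exists_cylinderWeight_eq_windowWeight (m := m) (a := 33) (b := 132) (t := t)
    (by omega)
  exact ⟨y, by omega⟩

/-- One block per residue, of 8, 4, 5, 6, 7 columns including the leading 33, 132; all have excess 2
except the perfect period, with excess 0. -/
theorem exists_cylinderWeight_eq (m : ℕ) : ∃ y : Fin (m + 3) → Column, cylinderWeight y =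
    if m + 3 ≡ 0 [MOD 5] then 4 * (m + 3) else 4 * (m + 3) + 2 := by
  have hm := Nat.div_add_mod m 5
  have : m % 5 < 5 := Nat.mod_lt _ (by norm_num)
  have h5 : m + 3 ≡ 0 [MOD 5] ↔ m % 5 = 2 := by unfold Nat.ModEq; omega
  interval_cases h : m % 5
  · rw [if_neg (h5.not.2 (by omega))]
    obtain hk | ⟨k, hk⟩ : m / 5 = 0 ∨ ∃ k, m / 5 = k + 1 := by
      cases m / 5 <;> simp
    · obtain rfl : m = 0 := by omega
      -- The block of eight columns does not fit n = 3. Here the columns are empty, rows {2, 6} and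
      -- rows {0, 4, 8}; four vertices of the empty column stay undominated, for weight 14.
      obtain ⟨y, hy⟩ := exists_cylinderWeight_eq_windowWeight (m := 0) (a := 0) (b := 68)
        (t := [273]) rfl
      exact ⟨y, hy.trans (by decide)⟩
    · exact exists_cylinderWeight_eq_add [16, 321, 4, 144, 66, 264] k
        (by simp only [List.length_cons, List.length_nil]; omega) (by decide)
  · rw [if_neg (h5.not.2 (by omega))]
    exact exists_cylinderWeight_eq_add [18, 264] (m / 5)
      (by simp only [List.length_cons, List.length_nil]; omega) (by decide)
  · rw [if_pos (h5.2 (by omega))]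
    exact exists_cylinderWeight_eq_add (c := 0) [16, 66, 264] (m / 5)
      (by simp only [List.length_cons, List.length_nil]; omega) (by decide)
  · rw [if_neg (h5.not.2 (by omega))]
    exact exists_cylinderWeight_eq_add [144, 18, 66, 264] (m / 5)
      (by simp only [List.length_cons, List.length_nil]; omega) (by decide)
  · rw [if_neg (h5.not.2 (by omega))]
    exact exists_cylinderWeight_eq_add [16, 65, 264, 34, 136] (m / 5)
      (by simp only [List.length_cons, List.length_nil]; omega) (by decide)

theorem mainTheorem5 (n : ℕ) (hn : 3 ≤ n) :
    (SimpleGraph.boxProd (SimpleGraph.pathGraph 9)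
      (SimpleGraph.cycleGraph n)).romanDominationNumber =
      if n ≡ 0 [MOD 5] then 4 * n else 4 * n + 2 := by
  obtain ⟨m, rfl⟩ : ∃ m, n = m + 3 := ⟨n - 3, by omega⟩
  refine (SimpleGraph.isLeast_romanDominationNumber _).unique ⟨?_, ?_⟩
  · obtain ⟨y, hy⟩ := exists_cylinderWeight_eq m
    obtain ⟨f, hf, hfy⟩ := exists_isRomanDominating y
    exact ⟨f, hf, hfy.trans hy⟩
  · rintro k ⟨f, hf, rfl⟩
    obtain ⟨y, hy⟩ := exists_cylinderWeight_le hf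
    exact (le_cylinderWeight y).trans hy
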